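/- Let $k$ be an algebraically closed field, $n\ge 2$, and let $X$ be a finite set of points in $\mathbb P^n_k$ that is not contained in a hyperplane. Let $I=I(X)\subset R=k[x_0,\dots,x_n]$ be its defining ideal, with degree-2 part $I_2$. Let $U$ be a $k$-vector space with basis $e_0,\dots,e_n$, let $\delta:\bigwedge^{p}U\otimes R\to\bigwedge^{p-1}U\otimes R$ be the Koszul differential of $x_0,\dots,x_n$ (with $\delta(e_i)=x_i$), and let $$\alpha=\sum_{|J|=n-2}\epsilon_J\otimes F_{J^c}\in \bigwedge^{n-2}U\otimes I_2,\qquad \delta(\alpha)=0 ,$$ where $J$ runs over the $(n-2)$-element subsets of $\{0,\dots,n\}$, $\epsilon_J=e_{j_1}\wedge\dots\wedge e_{j_{n-2}}$ for $J=\{j_1<\dots<j_{n-2}\}$, and $J^c=\{0,\dots,n\}\setminus J$. (For $n=2$ the condition $\delta(\alpha)=0$ is empty.) Assume that no quadric $F_C$ contains a monomial $x_l^2$; this is automatic if the coordinate points belong to $X$. For three distinct indices $a,b,c$ write $F_{abc}=F_{\{a,b,c\}}$. **Theorem 3.1.** Let $j\in\{0,\dots,n\}$ and let $S\subset\{0,\dots,n\}\setminus\{j\}$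 have $m$ elements. Suppose that $F_{efj}\in (x_j)$ for all $e\ne f$ in $S$, and write $F_{efj}=x_jL_{ef}$. Let $V\subset R$ be the $k$-vector space spanned by the linear forms $L_{ef}$ with $e\neq f$ in $S$, let $d=\dim_k V$, and suppose that $0<d<m-1$. Then there are an integer $t$ with $0<t\le d$, linear forms $L_1,\dots,L_t$ that are part of a basis of $V$, and linearly independent linear forms $h_1,\dots,h_{m-1-t}\in R$, such that $$(L_1,\dots,L_t)(h_1,\dots,h_{m-1-t})\subset I(X).$$ -/

import Mathlib

open scoped LinearAlgebra.Projectivization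

noncomputable section

/-- The homogeneous coordinate ring `k[x_0, …, x_n]` of projective `n`-space. -/
abbrev CoordRing (k : Type*) [Field k] (n : ℕ) : Type _ := MvPolynomial (Fin (n + 1)) k

/-- The defining ideal `I(X)` of a set `X` of points of `ℙⁿ`: all polynomials that vanish at every
nonzero vector representing a point of `X` (over an infinite field, this is the ideal generated by
the forms that vanish on `X`). -/
def definingIdeal {k : Type*} [Field k] {n : ℕ} (X : Set (ℙ k (Fin (n + 1) → k))) :
    Ideal (CoordRing k n) :=
  MvPolynomial.vanishingIdeal k
    {v : Fin (n + 1) → k | ∃ hv : v ≠ 0, Projectivization.mk k v hv ∈ X}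

/-- The Koszul differential of `x_0, …, x_n` in coordinates. An element
`∑_J ε_J ⊗ α_J` of `⋀ᵖ V ⊗ R`, where `ε_J = e_{j_1} ∧ … ∧ e_{j_p}` for `J = {j_1 < … < j_p}`,
is given by its coefficients `α_J` (only the values of `α` at the sets with `p` elements matter).
As `δ(ε_J) = ∑_r (-1)^{r-1} ε_{J \ {j_r}} ⊗ x_{j_r}`, the coefficient of `δ(∑_J ε_J ⊗ α_J)` at
`ε_S`, with `S` of `p - 1` elements, is the sum below. -/
def koszulDiff {k : Type*} [Field k] {n : ℕ} (α : Finset (Fin (n + 1)) → CoordRing k n)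
    (S : Finset (Fin (n + 1))) : CoordRing k n :=
  ∑ l ∈ Sᶜ, (-1) ^ (S.filter (fun p => p < l)).card * MvPolynomial.X l * α (insert l S)

/-- `α = ∑_J ε_J ⊗ α_J` belongs to `(⋀ⁿ⁻² V ⊗ I(X)_2) ∩ ker δ_{n-2}`. -/
structure IsLinearSyzygy {k : Type*} [Field k] {n : ℕ} (X : Set (ℙ k (Fin (n + 1) → k)))
    (α : Finset (Fin (n + 1)) → CoordRing k n) : Prop where
  mem_ideal : ∀ J : Finset (Fin (n + 1)), J.card + 2 = n → α J ∈ definingIdeal X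
  quadric : ∀ J : Finset (Fin (n + 1)), J.card + 2 = n → (α J).IsHomogeneous 2
  cycle : ∀ S : Finset (Fin (n + 1)), S.card + 3 = n → koszulDiff α S = 0

/-- The quadric `F_C` of `α`, for a set `C = {a, b, c}` of three indices: the coefficient of `α`
at `ε_J`, where `J` is the complement of `C`. -/
def specialQuadric {k : Type*} [Field k] {n : ℕ} (α : Finset (Fin (n + 1)) → CoordRing k n)
    (C : Finset (Fin (n + 1))) : CoordRing k n :=
  α Cᶜ

/-- Square-free polynomial in the sense of monomials: no variable has an exponent above `1`. -/
def IsSquarefreeForm {k : Type*} [Field k] {n : ℕ} (q : CoordRing k n) : Prop :=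
  ∀ u ∈ q.support, ∀ l, u l ≤ 1

/-- The vector space spanned by the forms `L_{ef}` with `e ≠ f` in `S`. -/
def formSpan {k : Type*} [Field k] {n : ℕ} (S : Finset (Fin (n + 1)))
    (L : Fin (n + 1) → Fin (n + 1) → CoordRing k n) : Submodule k (CoordRing k n) :=
  Submodule.span k {q | ∃ e ∈ S, ∃ f ∈ S, e ≠ f ∧ q = L e f}

/-- If the coordinate points lie on `X`, all quadrics through `X` are square-free. -/
theorem isSquarefreeForm_of_coordPoints {k : Type*} [Field k] {n : ℕ}
    (X : Set (ℙ k (Fin (n + 1) → k)))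
    (hX : ∀ (l : Fin (n + 1)) (hl : (Pi.single l 1 : Fin (n + 1) → k) ≠ 0),
      Projectivization.mk k (Pi.single l 1) hl ∈ X)
    (q : CoordRing k n) (hq : q.IsHomogeneous 2) (hqX : q ∈ definingIdeal X) :
    IsSquarefreeForm q := by
  intro u hu l
  by_contra hul
  have hne : (Pi.single l 1 : Fin (n + 1) → k) ≠ 0 := by
    intro h
    have := congrFun h l
    simp at this
  have h0 : MvPolynomial.eval (Pi.single l 1 : Fin (n + 1) → k) q = 0 := by
    have := hqX (Pi.single l 1) ⟨hne, hX l hne⟩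
    simpa [MvPolynomial.aeval_eq_eval] using this
  have key : ∀ v ∈ q.support, 2 ≤ v l → v = Finsupp.single l 2 := by
    intro v hv hvl
    have hdeg : v.degree = 2 := by
      have := hq (MvPolynomial.mem_support_iff.mp hv)
      rwa [Finsupp.degree_eq_weight_one]
    have hsum : ∑ i, v i = 2 := by
      rw [← hdeg, Finsupp.degree_eq_sum]
    have hsplit := Finset.add_sum_erase Finset.univ (fun i => v i) (Finset.mem_univ l)
    have hz : ∑ i ∈ Finset.univ.erase l, v i = 0 := by
      omega
    ext i
    by_cases hi : i = l
    · subst hi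
      rw [Finsupp.single_eq_same]
      omega
    · rw [Finsupp.single_eq_of_ne hi]
      exact (Finset.sum_eq_zero_iff.mp hz) i (by simp [hi])
  have hu2 := key u hu (by omega)
  rw [MvPolynomial.eval_eq'] at h0
  rw [Finset.sum_eq_single u] at h0
  · rw [Finset.prod_eq_one] at h0
    · simp at h0
      exact (MvPolynomial.mem_support_iff.mp hu) h0
    · intro i _
      by_cases hi : i = l
      · subst hi; simp
      · rw [hu2, Finsupp.single_eq_of_ne hi, pow_zero]
  · intro v hv hvu
    have hvl : v l < 2 := by
      by_contra hc
      exact hvu ((key v hv (by omega)).trans hu2.symm)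
    have hdeg : v.degree = 2 := by
      have := hq (MvPolynomial.mem_support_iff.mp hv)
      rwa [Finsupp.degree_eq_weight_one]
    have : ∃ i, i ≠ l ∧ v i ≠ 0 := by
      by_contra hc
      push Not at hc
      rw [Finsupp.degree_eq_sum, Finset.sum_eq_single l (fun i _ hi => hc i hi) (by simp)] at hdeg
      omega
    obtain ⟨i, hi, hvi⟩ := this
    rw [Finset.prod_eq_zero (Finset.mem_univ i), mul_zero]
    simp [hi, hvi]
  · intro h
    exact absurd hu h

end

/-! Write `m = S.card` and `V = formSpan S L`. The cycle condition at the complement of `{a, b, c,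
j}`, divided by `x_j`, expresses `F_abc` up to sign through the products `x_a L_bc`, `x_b L_ac`,
`x_c L_ab`. Hence at a point `p` of `X` the vector `y = (x_s)`, `s ∈ S`, and the alternating matrix
`ω = (± L_ab(p))` satisfy `y ∧ ω = 0`. If `y` and `ω` are nonzero, then `ω = y ∧ z`, which
determines a plane `Y_p` in `k^S`.

It suffices to find a set `c` of such points for which the functionals `N` killing the planes over
`c` and the forms `W ⊆ V` vanishing at the points off `c` satisfy `dim N + dim W ≥ m - 1`, with `W ≠
0`: products of elements of `W` and `N` vanish on `X`.

To find `c`, let `u` be the functional with indeterminate coefficients, over the field `K` they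
generate. Call `f` a multiplier if some functional `v` equals `f p • u` on each `Y_p`; let `c` be a
class of points not separated by multipliers. Differentiating `v = f u` in the coefficient `u_b`
gives `f e_b = ∂_b v - (∂_b f) u`. So multipliers preserve the module of functionals plus `B u`,
where `B` is the algebra of functions constant on classes (`multiplierSet_genericForm_subset`). The
stabilizer is an algebra, so it contains the indicator of `c`: for every `w` one can write `1_c w =
w' + β u` with `β` in `B`. Contracting `ω` with `u` and `w` on `c`, and extending by `0`, thus gives
the values of a form of `V ⊗ K` vanishing off `c`. This map has rank at most `dim W` and kernel at
most `N + K u`, so `m ≤ 1 + dim N + dim W` (`card_le_of_stable`). -/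

open Matrix

/-! ### Multipliers of a functional on a family of planes -/

/-- The functions `f` on `P` for which some `v` satisfies `v = f p • u` as functionals on the
span of the vectors `Y p i`, for every `p`. -/
def multiplierSet {K σ P : Type*} [Field K] [Fintype σ] (u : σ → K) (Y : P → Fin 2 → σ → K) :
    Set (P → K) :=
  {f | ∃ v : σ → K, ∀ p i, v ⬝ᵥ Y p i = f p * (u ⬝ᵥ Y p i)}

/-- Two points are equivalent if no function of `multiplierSet u Y` separates them. -/
def SameClass {K σ P : Type*} [Field K] [Fintype σ] (u : σ → K) (Y : P → Fin 2 → σ → K)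
    (p p' : P) : Prop :=
  ∀ f ∈ multiplierSet u Y, f p = f p'

/-- The functions that are constant on the classes of `SameClass u Y`. -/
def classSubalgebra {K σ P : Type*} [Field K] [Fintype σ] (u : σ → K) (Y : P → Fin 2 → σ → K) :
    Subalgebra K (P → K) where
  carrier := {g | ∀ p p', SameClass u Y p p' → g p = g p'}
  mul_mem' ha hb p p' h := by simp [ha p p' h, hb p p' h]
  add_mem' ha hb p p' h := by simp [ha p p' h, hb p p' h]
  algebraMap_mem' r p p' _ := rfl

/-- The functions of `classSubalgebra u Y` that preserve the module generated by all functionals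
together with the products of `u` by functions of `classSubalgebra u Y`. -/
def stabilizerSubalgebra {K σ P : Type*} [Field K] [Fintype σ] (u : σ → K)
    (Y : P → Fin 2 → σ → K) : Subalgebra K (P → K) where
  carrier := {g | g ∈ classSubalgebra u Y ∧ ∀ w : σ → K, ∃ w' : σ → K,
    ∃ β ∈ classSubalgebra u Y, ∀ p i, g p * (w ⬝ᵥ Y p i) = w' ⬝ᵥ Y p i + β p * (u ⬝ᵥ Y p i)}
  mul_mem' := by
    rintro a b ⟨ha, ha'⟩ ⟨hb, hb'⟩
    refine ⟨mul_mem ha hb, fun w => ?_⟩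
    obtain ⟨w₁, β₁, h₁, e₁⟩ := hb' w
    obtain ⟨w₂, β₂, h₂, e₂⟩ := ha' w₁
    refine ⟨w₂, β₂ + a * β₁, add_mem h₂ (mul_mem ha h₁), fun p i => ?_⟩
    simp only [Pi.mul_apply, Pi.add_apply]
    linear_combination a p * e₁ p i + e₂ p i
  add_mem' := by
    rintro a b ⟨ha, ha'⟩ ⟨hb, hb'⟩
    refine ⟨add_mem ha hb, fun w => ?_⟩
    obtain ⟨w₁, β₁, h₁, e₁⟩ := hb' w
    obtain ⟨w₂, β₂, h₂, e₂⟩ := ha' w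
    refine ⟨w₁ + w₂, β₁ + β₂, add_mem h₁ h₂, fun p i => ?_⟩
    simp only [Pi.add_apply, add_dotProduct]
    linear_combination e₁ p i + e₂ p i
  algebraMap_mem' r := by
    refine ⟨algebraMap_mem _ r, fun w => ⟨r • w, 0, zero_mem _, fun p i => ?_⟩⟩
    simp [Pi.algebraMap_apply]

/-- The indicator is a product of interpolating factors, one for each `q`: the factor is `1` at `p₀`
and, if `q` lies outside `c`, it is `0` at `q`. -/
theorem indicator_mem_of_separates {K P : Type*} [Field K] [Fintype P] (A : Subalgebra K (P → K))
    (c : P → Prop) [DecidablePred c] (p₀ : P) (hc : ∀ p, c p → ∀ f ∈ A, f p = f p₀)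
    (hs : ∀ p, ¬ c p → ∃ f ∈ A, f p ≠ f p₀) : (fun p => if c p then (1 : K) else 0) ∈ A := by
  classical
  have h : ∀ q, ∃ f ∈ A, f p₀ = 1 ∧ (¬ c q → f q = 0) := by
    intro q
    by_cases hq : c q
    · exact ⟨1, one_mem _, rfl, fun h => absurd hq h⟩
    · obtain ⟨f, hf, hne⟩ := hs q hq
      refine ⟨(f p₀ - f q)⁻¹ • (f - algebraMap K (P → K) (f q)),
        A.smul_mem (sub_mem hf (algebraMap_mem _ _)) _, ?_, ?_⟩
      · have : f p₀ - f q ≠ 0 := sub_ne_zero.mpr (Ne.symm hne)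
        simp [Pi.algebraMap_apply, this]
      · intro _
        simp [Pi.algebraMap_apply]
  choose f hfA hf₀ hf using h
  have hm : ∏ q, f q ∈ A := prod_mem fun q _ => hfA q
  convert hm using 1
  ext p
  split_ifs with hp
  · rw [hc p hp _ hm, Finset.prod_apply]
    simp [hf₀]
  · rw [Finset.prod_apply]
    exact (Finset.prod_eq_zero (f := fun q => f q p) (Finset.mem_univ p) (hf p hp)).symm

section Class

variable {K σ P : Type*} [Field K] [Fintype σ] [Fintype P] {u : σ → K} {Y : P → Fin 2 → σ → K}

open Classical in
theorem indicator_class_mem_stabilizerSubalgebra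
    (H : multiplierSet u Y ⊆ stabilizerSubalgebra u Y) (p₀ : P) :
    (fun p => if SameClass u Y p p₀ then (1 : K) else 0) ∈ stabilizerSubalgebra u Y := by
  refine indicator_mem_of_separates _ _ p₀ (fun p hp f hf => hf.1 p p₀ hp) fun p hp => ?_
  simp only [SameClass, not_forall] at hp
  obtain ⟨f, hf, hne⟩ := hp
  exact ⟨f, H hf, hne⟩

/-- Cutting `w` off outside the class by the stabilizing indicator turns a proportionality that
holds only on the class into a multiplier, up to a function of `classSubalgebra`. Both are constant
on the class. -/
theorem eq_of_proportional_on_class (H : multiplierSet u Y ⊆ stabilizerSubalgebra u Y)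
    (p₀ : P) {w : σ → K} {g : P → K}
    (hw : ∀ p, SameClass u Y p p₀ → ∀ i, w ⬝ᵥ Y p i = g p * (u ⬝ᵥ Y p i))
    (p : P) (hp : SameClass u Y p p₀) : g p = g p₀ := by
  classical
  obtain ⟨-, h⟩ := indicator_class_mem_stabilizerSubalgebra H p₀
  obtain ⟨w', β, hβ, e⟩ := h w
  have hmem : (fun p => (if SameClass u Y p p₀ then g p else 0) - β p) ∈ multiplierSet u Y := by
    refine ⟨w', fun q i => ?_⟩
    have := e q i
    by_cases hq : SameClass u Y q p₀
    · simp only [hq, if_true, hw q hq i] at this ⊢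
      linear_combination -this
    · simp only [hq, if_false] at this ⊢
      linear_combination -this
  have h1 := hp _ hmem
  have h2 := hβ p p₀ hp
  have h3 : SameClass u Y p₀ p₀ := fun _ _ => rfl
  simp only [hp, h3, if_true, h2] at h1
  exact sub_left_injective h1

end Class

/-! ### Base change and the dimension count -/

theorem finrank_ker_mulVecLin_map_le {k K J ι : Type*} [Field k] [Field K] [Algebra k K]
    [Fintype J] [Fintype ι] (M : Matrix J ι k) :
    Module.finrank K (LinearMap.ker (M.map (algebraMap k K)).mulVecLin) ≤
      Module.finrank k (LinearMap.ker M.mulVecLin) := by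
  have h1 := (M.map (algebraMap k K)).mulVecLin.finrank_range_add_finrank_ker
  have h2 := M.mulVecLin.finrank_range_add_finrank_ker
  have h3 : M.rank ≤ (M.map (algebraMap k K)).rank := by
    obtain ⟨κ, a, -, hsp, hli⟩ := exists_linearIndependent' k M.row
    have hr : M.rank = Nat.card κ := by
      rw [rank_eq_finrank_span_row, ← hsp]
      have : Finite κ := hli.finite
      have := Fintype.ofFinite κ
      rw [finrank_span_eq_card hli, Nat.card_eq_fintype_card]
    have : Finite κ := hli.finite
    have := Fintype.ofFinite κ
    -- Independent rows over `k` stay independent over `K`, so the rank does not drop.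
    have hK := (linearIndependent_algebraMap_comp_iff (S := K)).mpr hli
    rw [hr, rank_eq_finrank_span_row, Nat.card_eq_fintype_card, ← finrank_span_eq_card hK]
    apply Submodule.finrank_mono
    apply Submodule.span_mono
    rintro _ ⟨i, rfl⟩
    exact ⟨a i, rfl⟩
  simp only [Module.finrank_fintype_fun_eq_card, Matrix.rank] at h1 h2 h3
  omega

/-- The equations `v ⬝ᵥ Y p i = 0` for `p` in `c`. -/
def restrictedEquations {K σ P : Type*} (Y : P → Fin 2 → σ → K) (c : P → Prop) :
    Matrix ({p // c p} × Fin 2) σ K :=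
  Matrix.of fun q a => Y q.1 q.2 a

/-- The equations `ℓ p ⬝ᵥ x = 0` for `p` outside `c`. -/
def complementEquations {K ι P : Type*} (l : P → ι → K) (c : P → Prop) :
    Matrix {p // ¬ c p} ι K :=
  Matrix.of fun p i => l p i

theorem mem_ker_restrictedEquations {K σ P : Type*} [CommRing K] [Fintype σ]
    {Y : P → Fin 2 → σ → K} {c : P → Prop} {w : σ → K} :
    w ∈ LinearMap.ker (restrictedEquations Y c).mulVecLin ↔
      ∀ p, c p → ∀ i, w ⬝ᵥ Y p i = 0 := by
  simp only [LinearMap.mem_ker, mulVecLin_apply, funext_iff, Prod.forall, Subtype.forall,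
    mulVec, restrictedEquations, dotProduct_comm w, Pi.zero_apply]
  rfl

theorem mem_ker_complementEquations {K ι P : Type*} [CommRing K] [Fintype ι]
    {l : P → ι → K} {c : P → Prop} {x : ι → K} :
    x ∈ LinearMap.ker (complementEquations l c).mulVecLin ↔ ∀ p, ¬ c p → l p ⬝ᵥ x = 0 := by
  simp only [LinearMap.mem_ker, mulVecLin_apply, funext_iff, Subtype.forall,
    mulVec, complementEquations, Pi.zero_apply]
  rfl

/-- The values at the points of `P` of the contraction with `u` of the form `Y p 0 ∧ Y p 1`. -/
def contraction {K σ P : Type*} [CommRing K] [Fintype σ] (u : σ → K) (Y : P → Fin 2 → σ → K)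
    (w : σ → K) (p : P) : K :=
  (u ⬝ᵥ Y p 0) * (w ⬝ᵥ Y p 1) - (u ⬝ᵥ Y p 1) * (w ⬝ᵥ Y p 0)

/-- Contractions with `u` are values of members of the linear system; this is where the coordinates
`l p` of the points enter. -/
theorem contraction_eq_sum {K σ ι P : Type*} [Field K] [Fintype σ] [Fintype ι]
    {Y : P → Fin 2 → σ → K} {l : P → ι → K} {C : σ → σ → ι → K} (u : σ → K)
    (hC : ∀ p a b, Y p 0 a * Y p 1 b - Y p 1 a * Y p 0 b = l p ⬝ᵥ C a b) (w : σ → K) (p : P) :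
    contraction u Y w p = l p ⬝ᵥ ∑ a, ∑ b, (u a * w b) • C a b := by
  simp only [dotProduct_sum, dotProduct_smul, ← hC, contraction, smul_eq_mul]
  simp only [dotProduct, Finset.sum_mul_sum, ← Finset.sum_sub_distrib]
  refine Finset.sum_congr rfl fun a _ => Finset.sum_congr rfl fun b _ => ?_
  ring

theorem card_le_of_stable {K σ ι P : Type*} [Field K] [Fintype σ] [Fintype ι] [Fintype P]
    {u : σ → K} {Y : P → Fin 2 → σ → K} {l : P → ι → K} {C : σ → σ → ι → K}
    (hC : ∀ p a b, Y p 0 a * Y p 1 b - Y p 1 a * Y p 0 b = l p ⬝ᵥ C a b)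
    (hu : ∀ p, u ⬝ᵥ Y p 0 ≠ 0) (H : multiplierSet u Y ⊆ stabilizerSubalgebra u Y) (p₀ : P) :
    Fintype.card σ ≤ 1 +
      Module.finrank K (LinearMap.ker
        (restrictedEquations Y fun p => SameClass u Y p p₀).mulVecLin) +
      Module.finrank K (LinearMap.ker
        (complementEquations l fun p => SameClass u Y p p₀).mulVecLin) := by
  classical
  set c : P → Prop := fun p => SameClass u Y p p₀ with hc
  let Φ : (σ → K) →ₗ[K] (P → K) :=
    { toFun := fun w p => if c p then contraction u Y w p else 0
      map_add' := fun w w' => by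
        ext p
        by_cases hp : c p <;> simp [hp, contraction, add_dotProduct]
        ring
      map_smul' := fun r w => by
        ext p
        by_cases hp : c p <;> simp [hp, contraction]
        ring }
  have hΦ : ∀ w p, Φ w p = if c p then contraction u Y w p else 0 := fun w p => rfl
  -- Contraction with `u` kills the term `β u` in `1_c w = w' + β u`, so `Φ w` is the contraction of
  -- `w'`, hence comes from the linear system.
  have hrange : LinearMap.range Φ ≤ (LinearMap.ker (complementEquations l c).mulVecLin).map
      (Matrix.of l).mulVecLin := by
    rintro _ ⟨w, rfl⟩
    obtain ⟨w', β, -, e⟩ := (indicator_class_mem_stabilizerSubalgebra H p₀).2 w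
    have key : ∀ p, contraction u Y w' p = Φ w p := by
      intro p
      have e0 := e p 0
      have e1 := e p 1
      rw [hΦ]
      simp only [contraction]
      by_cases hp : c p
      · simp only [hc] at hp
        simp only [hp, if_true, hc] at e0 e1 ⊢
        linear_combination (u ⬝ᵥ Y p 1) * e0 - (u ⬝ᵥ Y p 0) * e1
      · simp only [hc] at hp
        simp only [hp, if_false, hc] at e0 e1 ⊢
        linear_combination (u ⬝ᵥ Y p 1) * e0 - (u ⬝ᵥ Y p 0) * e1
    refine ⟨∑ a, ∑ b, (u a * w' b) • C a b, ?_, ?_⟩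
    · refine mem_ker_complementEquations.mpr fun p hp => ?_
      rw [← contraction_eq_sum u hC, key, hΦ, if_neg hp]
    · ext p
      rw [← key, contraction_eq_sum u hC]
      rfl
  -- If the contraction vanishes on `c`, then `w` is proportional to `u` on each plane over `c`. The
  -- ratio `g` is constant there, so `w` minus a multiple of `u` kills these planes.
  have hker : LinearMap.ker Φ ≤
      LinearMap.ker (restrictedEquations Y c).mulVecLin ⊔ Submodule.span K {u} := by
    intro w hw
    have hw0 : ∀ p, c p → contraction u Y w p = 0 := fun p hp => by
      have := congrFun (LinearMap.mem_ker.mp hw) p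
      rwa [hΦ, if_pos hp] at this
    let g : P → K := fun p => (w ⬝ᵥ Y p 0) / (u ⬝ᵥ Y p 0)
    have hg : ∀ p, c p → ∀ i, w ⬝ᵥ Y p i = g p * (u ⬝ᵥ Y p i) := by
      intro p hp i
      have h := hw0 p hp
      have hup := hu p
      simp only [contraction] at h
      simp only [g]
      fin_cases i
      · simp [hup]
      · simp only [Fin.mk_one]
        field_simp
        linear_combination h
    have hconst := eq_of_proportional_on_class H p₀ hg
    rw [← sub_add_cancel w (g p₀ • u)]
    refine Submodule.add_mem_sup ?_ (Submodule.smul_mem _ _ (Submodule.mem_span_singleton_self u))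
    refine mem_ker_restrictedEquations.mpr fun p hp i => ?_
    rw [sub_dotProduct, smul_dotProduct, hg p hp i, hconst p hp, smul_eq_mul, sub_self]
  have h1 := Submodule.finrank_mono hrange
  have h2 := Submodule.finrank_map_le (Matrix.of l).mulVecLin
    (LinearMap.ker (complementEquations l c).mulVecLin)
  have h3 := Submodule.finrank_mono hker
  have h4 := Submodule.finrank_add_le_finrank_add_finrank
    (LinearMap.ker (restrictedEquations Y c).mulVecLin) (Submodule.span K {u})
  have h5 := finrank_span_le_card (R := K) ({u} : Set (σ → K))
  have h6 := Φ.finrank_range_add_finrank_ker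
  rw [Module.finrank_fintype_fun_eq_card] at h6
  simp only [Set.toFinset_singleton, Finset.card_singleton] at h5
  change _ ≤ 1 + Module.finrank K (LinearMap.ker (restrictedEquations Y c).mulVecLin) +
    Module.finrank K (LinearMap.ker (complementEquations l c).mulVecLin)
  omega

/-! ### The generic functional -/

section Generic

variable {k σ P : Type*} [Field k] [Fintype σ] [Fintype P]

/-- The linear form with indeterminate coefficients. -/
noncomputable def genericForm (k σ : Type*) [Field k] : σ → FractionRing (MvPolynomial σ k) :=
  fun s => algebraMap (MvPolynomial σ k) _ (MvPolynomial.X s)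

theorem genericForm_dotProduct_ne_zero {y : σ → k} (hy : y ≠ 0) :
    genericForm k σ ⬝ᵥ (algebraMap k (FractionRing (MvPolynomial σ k)) ∘ y) ≠ 0 := by
  classical
  obtain ⟨s, hs⟩ := Function.ne_iff.mp hy
  have : genericForm k σ ⬝ᵥ (algebraMap k (FractionRing (MvPolynomial σ k)) ∘ y) =
      algebraMap (MvPolynomial σ k) _ (∑ a, MvPolynomial.X a * MvPolynomial.C (y a)) := by
    simp [dotProduct, genericForm, IsScalarTower.algebraMap_apply k (MvPolynomial σ k)
      (FractionRing (MvPolynomial σ k)), MvPolynomial.algebraMap_eq]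
  rw [this, Ne, FaithfulSMul.algebraMap_eq_zero_iff]
  intro h
  have := congrArg (MvPolynomial.eval (Pi.single s 1)) h
  simp [Pi.single_apply] at this
  exact hs (by simpa using this)

theorem multiplierSet_genericForm_subset (Y : P → Fin 2 → σ → k) :
    multiplierSet (genericForm k σ)
        (fun p i => algebraMap k (FractionRing (MvPolynomial σ k)) ∘ Y p i) ⊆
      stabilizerSubalgebra (genericForm k σ)
        (fun p i => algebraMap k (FractionRing (MvPolynomial σ k)) ∘ Y p i) := by
  classical
  set A := MvPolynomial σ k
  set K := FractionRing A
  set u := genericForm k σ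
  set YK : P → Fin 2 → σ → K := fun p i => algebraMap k K ∘ Y p i with hYK
  intro f hf
  have hfB : f ∈ classSubalgebra u YK := fun p p' h => h f hf
  refine ⟨hfB, fun w => ?_⟩
  -- By linearity in `w`, only coordinate functionals matter.
  suffices hb : ∀ b : σ, ∃ w' : σ → K, ∃ β ∈ classSubalgebra u YK, ∀ p i,
      f p * YK p i b = w' ⬝ᵥ YK p i + β p * (u ⬝ᵥ YK p i) by
    choose w' β hβ e using hb
    refine ⟨∑ b, w b • w' b, ∑ b, w b • β b,
      sum_mem fun b _ => Subalgebra.smul_mem _ (hβ b) _, fun p i => ?_⟩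
    simp only [sum_dotProduct, smul_dotProduct, Finset.sum_apply, Pi.smul_apply, smul_eq_mul,
      Finset.sum_mul, ← Finset.sum_add_distrib]
    rw [dotProduct, Finset.mul_sum]
    refine Finset.sum_congr rfl fun b _ => ?_
    linear_combination w b * e b p i
  intro b
  obtain ⟨v, hv⟩ := hf
  -- A common denominator `q` of `f` and `v` makes `F = q f` and `V = q v` polynomial, so that
  -- `pderiv` applies to `V = F u`.
  obtain ⟨⟨q, hq⟩, hint⟩ := IsLocalization.exist_integer_multiples_of_finite
    (nonZeroDivisors A) (Sum.elim f v)
  have hq0 : algebraMap A K q ≠ 0 := by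
    rw [Ne, FaithfulSMul.algebraMap_eq_zero_iff]
    exact nonZeroDivisors.ne_zero hq
  have hF : ∀ p, ∃ a : A, algebraMap A K a = algebraMap A K q * f p := fun p => by
    simpa [Algebra.smul_def, IsLocalization.IsInteger] using hint (Sum.inl p)
  have hV : ∀ s, ∃ a : A, algebraMap A K a = algebraMap A K q * v s := fun s => by
    simpa [Algebra.smul_def, IsLocalization.IsInteger] using hint (Sum.inr s)
  choose F hF using hF
  choose V hV using hV
  have hinj : Function.Injective (algebraMap A K) := FaithfulSMul.algebraMap_injective A K
  have hdot : ∀ (G : σ → A) p i, algebraMap A K (∑ s, G s * MvPolynomial.C (Y p i s)) =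
      (fun s => algebraMap A K (G s)) ⬝ᵥ YK p i := fun G p i => by
    simp [dotProduct, hYK, IsScalarTower.algebraMap_apply k A K, A, MvPolynomial.algebraMap_eq]
  have hpoly : ∀ p i, ∑ s, V s * MvPolynomial.C (Y p i s) =
      F p * ∑ s, MvPolynomial.X s * MvPolynomial.C (Y p i s) := fun p i => by
    apply hinj
    rw [map_mul, hdot, hdot, hF]
    have : (fun s => algebraMap A K (V s)) = algebraMap A K q • v := by
      ext s
      simp [hV]
    rw [this, smul_dotProduct, hv p i, smul_eq_mul, mul_assoc]
    rfl
  let D := MvPolynomial.pderiv (R := k) b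
  have hFB : ∀ p p', SameClass u YK p p' → F p = F p' := fun p p' h => by
    apply hinj
    rw [hF, hF, hfB p p' h]
  -- The Leibniz rule gives `∂_b V = (∂_b F) u + F e_b` on each plane; divide by `q` and solve for
  -- `f e_b`.
  refine ⟨fun s => (algebraMap A K q)⁻¹ * algebraMap A K (D (V s)),
    fun p => -((algebraMap A K q)⁻¹ * algebraMap A K (D (F p))), ?_, fun p i => ?_⟩
  · intro p p' h
    simp [hFB p p' h]
  have hd := congrArg (fun a => algebraMap A K (D a)) (hpoly p i)
  have hDsum : ∀ G : σ → A, D (∑ s, G s * MvPolynomial.C (Y p i s)) =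
      ∑ s, D (G s) * MvPolynomial.C (Y p i s) := fun G => by
    simp [D, Derivation.leibniz, mul_comm]
  have hDX : ∑ s, D (MvPolynomial.X s) * MvPolynomial.C (Y p i s) = MvPolynomial.C (Y p i b) := by
    simp [D, MvPolynomial.pderiv_X, Pi.single_apply]
  simp only [Derivation.leibniz, hDsum, hDX, smul_eq_mul, map_add, map_mul, hdot, hF] at hd
  have hw : (fun s => (algebraMap A K q)⁻¹ * algebraMap A K (D (V s))) =
      (algebraMap A K q)⁻¹ • fun s => algebraMap A K (D (V s)) := rfl
  have hC : algebraMap A K (MvPolynomial.C (Y p i b)) = YK p i b := by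
    simp [hYK, IsScalarTower.algebraMap_apply k A K, A, MvPolynomial.algebraMap_eq]
  rw [hw, smul_dotProduct, hd, hC, smul_eq_mul]
  change _ = _ * (_ + (u ⬝ᵥ YK p i) * _) + _
  field_simp
  ring

end Generic

/-! ### Descent to the ground field -/

/-- Given nonzero decomposable alternating forms `Y p 0 ∧ Y p 1`, indexed by a finite set and lying
in a linear system, some nonempty subset spans few dimensions compared with the conditions imposed
on the linear system by the other points. -/
theorem exists_card_le_finrank_add_finrank {k σ ι P : Type*} [Field k] [Fintype σ] [Fintype ι]
    [Fintype P] [Nonempty P] (Y : P → Fin 2 → σ → k) (hY : ∀ p, Y p 0 ≠ 0) (l : P → ι → k)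
    (C : σ → σ → ι → k)
    (hC : ∀ p a b, Y p 0 a * Y p 1 b - Y p 1 a * Y p 0 b = l p ⬝ᵥ C a b) :
    ∃ c : P → Prop, (∃ p, c p) ∧ Fintype.card σ ≤ 1 +
      Module.finrank k (LinearMap.ker (restrictedEquations Y c).mulVecLin) +
      Module.finrank k (LinearMap.ker (complementEquations l c).mulVecLin) := by
  classical
  let K := FractionRing (MvPolynomial σ k)
  let YK : P → Fin 2 → σ → K := fun p i => algebraMap k K ∘ Y p i
  let p₀ : P := Classical.arbitrary P
  -- The class is defined over `K`, but it is only a subset of `P`: the equations it selects have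
  -- coefficients in `k`.
  let c : P → Prop := fun p => SameClass (genericForm k σ) YK p p₀
  refine ⟨c, ⟨p₀, fun _ _ => rfl⟩, ?_⟩
  have h := card_le_of_stable (u := genericForm k σ) (Y := YK)
    (l := fun p => algebraMap k K ∘ l p) (C := fun a b => algebraMap k K ∘ C a b)
    (fun p a b => by
      have := congrArg (algebraMap k K) (hC p a b)
      simpa [YK, dotProduct] using this)
    (fun p => genericForm_dotProduct_ne_zero (hY p))
    (multiplierSet_genericForm_subset Y) p₀
  have h1 := finrank_ker_mulVecLin_map_le (K := K) (restrictedEquations Y c)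
  have h2 := finrank_ker_mulVecLin_map_le (K := K) (complementEquations l c)
  exact h.trans (add_le_add (add_le_add le_rfl h1) h2)

/-- A nonzero form has a genuine plane, which costs two dimensions. In the inequality `m ≤ 1 + dim N
+ dim W` this forces `W ≠ 0`. -/
theorem finrank_ker_restrictedEquations_add_two_le {k σ P : Type*} [Field k] [Fintype σ]
    (Y : P → Fin 2 → σ → k) (c : P → Prop) {p : P} (hp : c p) {a b : σ}
    (hab : Y p 0 a * Y p 1 b - Y p 1 a * Y p 0 b ≠ 0) :
    Module.finrank k (LinearMap.ker (restrictedEquations Y c).mulVecLin) + 2 ≤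
      Fintype.card σ := by
  have hli : LinearIndependent k (Matrix.of (Y p)).row := by
    have : (Matrix.of (Y p)).row = ![Y p 0, Y p 1] := by
      ext i s
      fin_cases i <;> rfl
    rw [this, LinearIndependent.pair_iff]
    intro s t h
    have ha := congrFun h a
    have hb := congrFun h b
    simp only [Pi.add_apply, Pi.smul_apply, smul_eq_mul, Pi.zero_apply] at ha hb
    constructor
    · apply (mul_eq_zero.mp (_ : s * (Y p 0 a * Y p 1 b - Y p 1 a * Y p 0 b) = 0)).resolve_right hab
      linear_combination Y p 1 b * ha - Y p 1 a * hb
    · apply (mul_eq_zero.mp (_ : t * (Y p 0 a * Y p 1 b - Y p 1 a * Y p 0 b) = 0)).resolve_right hab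
      linear_combination Y p 0 a * hb - Y p 0 b * ha
  have hrank : (Matrix.of (Y p)).rank = 2 := by
    rw [hli.rank_matrix, Fintype.card_fin]
  have hle : LinearMap.ker (restrictedEquations Y c).mulVecLin ≤
      LinearMap.ker (Matrix.of (Y p)).mulVecLin := by
    intro w hw
    rw [mem_ker_restrictedEquations] at hw
    rw [LinearMap.mem_ker]
    ext i
    have := hw p hp i
    rwa [dotProduct_comm] at this
  have h1 := Submodule.finrank_mono hle
  have h2 := (Matrix.of (Y p)).mulVecLin.finrank_range_add_finrank_ker
  rw [Module.finrank_fintype_fun_eq_card] at h2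
  rw [Matrix.rank] at hrank
  omega

/-- A finite family of alternating forms `ω p`, depending linearly on vectors `l p`, each with
`y p ∧ ω p = 0`: a subset `c` of the indices for which the vectors `y p` with `p ∈ c` satisfy many
linear relations compared with those satisfied by the `l p` with `p ∉ c`. -/
theorem exists_subset_card_le {k σ ι P : Type*} [Field k] [Fintype σ] [Fintype ι] [Finite P]
    [Nonempty ι] (y : P → σ → k) (l : P → ι → k) (C : σ → σ → ι → k)
    (hy : ∀ p, y p ≠ 0) (hl : ∀ p, ∃ a b, l p ⬝ᵥ C a b ≠ 0)
    (hplucker : ∀ p a b c,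
      y p a * (l p ⬝ᵥ C b c) - y p b * (l p ⬝ᵥ C a c) + y p c * (l p ⬝ᵥ C a b) = 0) :
    ∃ (c : P → Prop) (N : Submodule k (σ → k)) (W : Submodule k (ι → k)),
      0 < Module.finrank k W ∧ Fintype.card σ ≤ 1 + Module.finrank k N + Module.finrank k W ∧
      (∀ w ∈ N, ∀ p, c p → w ⬝ᵥ y p = 0) ∧ (∀ x ∈ W, ∀ p, ¬ c p → l p ⬝ᵥ x = 0) := by
  cases nonempty_fintype P
  cases isEmpty_or_nonempty P
  · refine ⟨fun _ => True, ⊤, ⊤, ?_, ?_, fun _ _ p => isEmptyElim p, fun _ _ p => isEmptyElim p⟩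
    · simp [Fintype.card_pos]
    · simp only [finrank_top, Module.finrank_fintype_fun_eq_card]
      omega
  have hs : ∀ p, ∃ s, y p s ≠ 0 := fun p => Function.ne_iff.mp (hy p)
  choose s hs using hs
  -- The relation at `(s, a, b)`, divided by `y_s ≠ 0`, says that `ω = y ∧ z`, where `z` is row `s`
  -- of `ω` divided by `y_s`.
  let Y : P → Fin 2 → σ → k := fun p => ![y p, fun b => (l p ⬝ᵥ C (s p) b) / y p (s p)]
  have hC : ∀ p a b, Y p 0 a * Y p 1 b - Y p 1 a * Y p 0 b = l p ⬝ᵥ C a b := by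
    intro p a b
    have h := hplucker p (s p) a b
    have h0 := hs p
    simp only [Y, cons_val_zero, cons_val_one]
    field_simp
    linear_combination -h
  obtain ⟨c, ⟨p, hp⟩, hcard⟩ := exists_card_le_finrank_add_finrank Y (fun p => hy p) l C hC
  refine ⟨c, _, _, ?_, hcard, fun w hw p hp => mem_ker_restrictedEquations.mp hw p hp 0,
    fun x hx p hp => mem_ker_complementEquations.mp hx p hp⟩
  obtain ⟨a, b, hab⟩ := hl p
  rw [← hC] at hab
  have := finrank_ker_restrictedEquations_add_two_le Y c hp hab
  omega

/-! ### Adapted bases and linear forms -/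

theorem exists_basis_extending {k V : Type*} [Field k] [AddCommGroup V] [Module k V]
    [FiniteDimensional k V] (W : Submodule k V) :
    ∃ (b : Module.Basis (Fin (Module.finrank k V)) k V)
      (g : Fin (Module.finrank k W) ↪ Fin (Module.finrank k V)), ∀ a, b (g a) ∈ W := by
  obtain ⟨W', hW'⟩ := W.exists_isCompl
  let B := ((Module.finBasis k W).prod (Module.finBasis k W')).map
    (Submodule.prodEquivOfIsCompl W W' hW')
  let e := B.indexEquiv (Module.finBasis k V)
  refine ⟨B.reindex e, ⟨fun a => e (Sum.inl a), fun a a' h => Sum.inl_injective (e.injective h)⟩,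
    fun a => ?_⟩
  change B.reindex e (e (Sum.inl a)) ∈ W
  rw [Module.Basis.reindex_apply, Equiv.symm_apply_apply]
  simp [B]

theorem eval_smul_of_isHomogeneous_one {k τ : Type*} [Field k] {q : MvPolynomial τ k}
    (hq : q.IsHomogeneous 1) (r : k) (v : τ → k) :
    MvPolynomial.eval (r • v) q = r * MvPolynomial.eval v q := by
  rw [← MvPolynomial.mem_homogeneousSubmodule, MvPolynomial.homogeneousSubmodule_one_eq_span_X] at hq
  induction hq using Submodule.span_induction with
  | mem x h =>
    obtain ⟨i, rfl⟩ := h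
    simp
  | zero => simp
  | add x y _ _ hx hy => simp [hx, hy, mul_add]
  | smul a x _ hx => simp [MvPolynomial.smul_eval, hx, mul_left_comm]

theorem isHomogeneous_of_X_mul {k τ : Type*} [Field k] {q : MvPolynomial τ k} {i : τ} {d : ℕ}
    (h : (MvPolynomial.X i * q).IsHomogeneous (d + 1)) : q.IsHomogeneous d := by
  intro u hu
  have h1 : MvPolynomial.coeff (Finsupp.single i 1 + u) (MvPolynomial.X i * q) ≠ 0 := by
    rwa [MvPolynomial.coeff_X_mul]
  have h2 := h h1
  rw [map_add, Finsupp.weight_single, Pi.one_apply, smul_eq_mul, mul_one] at h2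
  omega

section LinearForm

variable {k τ : Type*} [Field k] (S : Finset τ)

/-- The linear form with given coefficients at the variables indexed by `S`. -/
noncomputable def linearFormOn : (S → k) →ₗ[k] MvPolynomial τ k :=
  Fintype.linearCombination k fun s : S => MvPolynomial.X (s : τ)

theorem linearFormOn_apply (w : S → k) :
    linearFormOn S w = ∑ s, w s • MvPolynomial.X (s : τ) := rfl

theorem isHomogeneous_linearFormOn (w : S → k) : (linearFormOn S w).IsHomogeneous 1 := by
  rw [linearFormOn_apply]
  refine MvPolynomial.IsHomogeneous.sum _ _ _ fun s _ => ?_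
  rw [MvPolynomial.smul_eq_C_mul]
  exact (MvPolynomial.isHomogeneous_X k _).C_mul _

theorem eval_linearFormOn (w : S → k) (v : τ → k) :
    MvPolynomial.eval v (linearFormOn S w) = w ⬝ᵥ fun s : S => v s := by
  simp [linearFormOn_apply, dotProduct, MvPolynomial.smul_eval]

theorem linearFormOn_injective : Function.Injective (linearFormOn (k := k) S) := by
  classical
  intro w w' h
  ext s
  have := congrArg (MvPolynomial.eval (Pi.single (s : τ) 1)) h
  simp only [eval_linearFormOn] at this
  have hs : (fun a : S => (Pi.single (s : τ) 1 : τ → k) a) = Pi.single s 1 := by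
    ext a
    by_cases h : a = s
    · simp [h]
    · rw [Pi.single_eq_of_ne h, Pi.single_eq_of_ne fun h' => h (Subtype.ext h')]
  simpa [hs] using this

end LinearForm

/-! ### Quadratic relations from the Koszul cycle -/

theorem neg_one_pow_card_filter_compl_lt {R : Type*} [CommRing R] {n : ℕ}
    (D : Finset (Fin (n + 1))) (l : Fin (n + 1)) :
    (-1 : R) ^ (Dᶜ.filter (fun p => p < l)).card =
      (-1) ^ (l : ℕ) * (-1) ^ (D.filter (fun p => p < l)).card := by
  have h : (Dᶜ.filter (fun p => p < l)).card + (D.filter (fun p => p < l)).card = (l : ℕ) := by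
    rw [add_comm, ← Finset.card_union_of_disjoint
      (Finset.disjoint_filter_filter disjoint_compl_right), ← Finset.filter_union,
      Finset.union_compl, ← Fin.card_Iio l]
    congr 1
    ext p
    simp
  rw [← h, pow_add, mul_assoc, ← pow_add, ← two_mul, pow_mul]
  simp

/-- The Koszul differential at the complement of `D`. -/
theorem koszulDiff_compl {k : Type*} [Field k] {n : ℕ} (α : Finset (Fin (n + 1)) → CoordRing k n)
    (D : Finset (Fin (n + 1))) :
    koszulDiff α Dᶜ = ∑ l ∈ D, (-1) ^ (l : ℕ) * (-1) ^ (D.filter (fun p => p < l)).card *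
      MvPolynomial.X l * specialQuadric α (D.erase l) := by
  rw [koszulDiff, compl_compl]
  refine Finset.sum_congr rfl fun l hl => ?_
  rw [neg_one_pow_card_filter_compl_lt, specialQuadric, Finset.compl_erase]

/-- The sign attached to the index `l` by the choice of `j`. -/
def indexSign (R : Type*) [CommRing R] {n : ℕ} (j l : Fin (n + 1)) : R :=
  (-1) ^ (l : ℕ) * if j < l then -1 else 1

theorem indexSign_mul_self (R : Type*) [CommRing R] {n : ℕ} (j l : Fin (n + 1)) :
    indexSign R j l * indexSign R j l = 1 := by
  have : ((-1 : R) ^ (l : ℕ)) * (-1) ^ (l : ℕ) = 1 := by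
    rw [← mul_pow]
    simp
  unfold indexSign
  split_ifs <;> linear_combination this

theorem map_indexSign {R R' : Type*} [CommRing R] [CommRing R'] (f : R →+* R') {n : ℕ}
    (j l : Fin (n + 1)) : f (indexSign R j l) = indexSign R' j l := by
  unfold indexSign
  split_ifs <;> simp

section Relation

variable {k : Type*} [Field k] {n : ℕ} {X : Set (ℙ k (Fin (n + 1) → k))}
  {α : Finset (Fin (n + 1)) → CoordRing k n} {j : Fin (n + 1)} {S : Finset (Fin (n + 1))}
  {L : Fin (n + 1) → Fin (n + 1) → CoordRing k n}

/-- In the cycle condition at the complement of `{a, b, c, j}`, three terms contain `x_j` through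
`F_efj = x_j L_ef` and the fourth is `± x_j F_abc`. After cancelling `x_j`, the expression equals `±
F_abc`. -/
theorem quadric_relation (hα : IsLinearSyzygy X α) (hj : j ∉ S)
    (hL : ∀ e ∈ S, ∀ f ∈ S, e ≠ f → specialQuadric α {e, f, j} = MvPolynomial.X j * L e f)
    {a b c : Fin (n + 1)} (ha : a ∈ S) (hb : b ∈ S) (hc : c ∈ S) (hab : a < b) (hbc : b < c) :
    indexSign (CoordRing k n) j a * MvPolynomial.X a * L b c -
      indexSign (CoordRing k n) j b * MvPolynomial.X b * L a c +
      indexSign (CoordRing k n) j c * MvPolynomial.X c * L a b ∈ definingIdeal X := by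
  have hac := hab.trans hbc
  have hja : j ≠ a := fun h => hj (h ▸ ha)
  have hjb : j ≠ b := fun h => hj (h ▸ hb)
  have hjc : j ≠ c := fun h => hj (h ▸ hc)
  let D : Finset (Fin (n + 1)) := {a, b, c, j}
  have hD : D.card = 4 := by
    simp [D, hab.ne, hbc.ne, hac.ne, hja.symm, hjb.symm, hjc.symm]
  have hDle : D.card ≤ n + 1 := by simpa using D.card_le_univ
  have hcyc := hα.cycle Dᶜ (by rw [Finset.card_compl, Fintype.card_fin]; omega)
  rw [koszulDiff_compl] at hcyc
  have hsum : ∀ f : Fin (n + 1) → CoordRing k n, ∑ l ∈ D, f l = f a + f b + f c + f j := by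
    intro f
    simp only [D]
    rw [Finset.sum_insert (by simp [hab.ne, hac.ne, hja.symm]),
      Finset.sum_insert (by simp [hbc.ne, hjb.symm]),
      Finset.sum_insert (by simp [hjc.symm]), Finset.sum_singleton]
    ring
  have ea : D.erase a = {b, c, j} := by
    ext x; simp only [D, Finset.mem_erase, Finset.mem_insert, Finset.mem_singleton]; grind
  have eb : D.erase b = {a, c, j} := by
    ext x; simp only [D, Finset.mem_erase, Finset.mem_insert, Finset.mem_singleton]; grind
  have ec : D.erase c = {a, b, j} := by
    ext x; simp only [D, Finset.mem_erase, Finset.mem_insert, Finset.mem_singleton]; grind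
  have ej : D.erase j = {a, b, c} := by
    ext x; simp only [D, Finset.mem_erase, Finset.mem_insert, Finset.mem_singleton]; grind
  have sa : (-1 : CoordRing k n) ^ (D.filter (fun p => p < a)).card =
      if j < a then -1 else 1 := by
    have : D.filter (fun p => p < a) = if j < a then {j} else ∅ := by
      split_ifs <;> ext x <;>
        simp only [D, Finset.mem_filter, Finset.mem_insert, Finset.mem_singleton,
          Finset.notMem_empty] <;> grind
    rw [this]; split_ifs <;> simp
  have sb : (-1 : CoordRing k n) ^ (D.filter (fun p => p < b)).card =
      -if j < b then -1 else 1 := by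
    have : D.filter (fun p => p < b) = if j < b then {a, j} else {a} := by
      split_ifs <;> ext x <;>
        simp only [D, Finset.mem_filter, Finset.mem_insert, Finset.mem_singleton] <;> grind
    rw [this]; split_ifs <;> simp [hja.symm]
  have sc : (-1 : CoordRing k n) ^ (D.filter (fun p => p < c)).card =
      if j < c then -1 else 1 := by
    have : D.filter (fun p => p < c) = if j < c then {a, b, j} else {a, b} := by
      split_ifs <;> ext x <;>
        simp only [D, Finset.mem_filter, Finset.mem_insert, Finset.mem_singleton] <;> grind
    rw [this]
    split_ifs
    · simp [hab.ne, hja.symm, hjb.symm, Odd.neg_one_pow (by decide : Odd 3)]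
    · simp [hab.ne]
  rw [hsum, ea, eb, ec, ej, hL b hb c hc hbc.ne, hL a ha c hc hac.ne, hL a ha b hb hab.ne,
    sa, sb, sc] at hcyc
  set ε : CoordRing k n := (-1) ^ (j : ℕ) * (-1) ^ (D.filter (fun p => p < j)).card
  have key : indexSign (CoordRing k n) j a * MvPolynomial.X a * L b c -
      indexSign (CoordRing k n) j b * MvPolynomial.X b * L a c +
      indexSign (CoordRing k n) j c * MvPolynomial.X c * L a b =
      -ε * specialQuadric α {a, b, c} := by
    apply mul_left_cancel₀ (MvPolynomial.X_ne_zero (R := k) j)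
    simp only [indexSign]
    linear_combination hcyc
  rw [key]
  refine Ideal.mul_mem_left _ _ (hα.mem_ideal _ ?_)
  have h3 : ({a, b, c} : Finset (Fin (n + 1))).card = 3 := by simp [hab.ne, hbc.ne, hac.ne]
  rw [Finset.card_compl, Fintype.card_fin, h3]
  omega

theorem isHomogeneous_form (hα : IsLinearSyzygy X α) (hj : j ∉ S)
    (hL : ∀ e ∈ S, ∀ f ∈ S, e ≠ f → specialQuadric α {e, f, j} = MvPolynomial.X j * L e f)
    {e f : Fin (n + 1)} (he : e ∈ S) (hf : f ∈ S) (hef : e ≠ f) : (L e f).IsHomogeneous 1 := by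
  apply isHomogeneous_of_X_mul (i := j)
  rw [← hL e he f hf hef]
  have h3 : ({e, f, j} : Finset (Fin (n + 1))).card = 3 := by
    have hje : j ≠ e := fun h => hj (h ▸ he)
    have hjf : j ≠ f := fun h => hj (h ▸ hf)
    simp [hef, hje.symm, hjf.symm]
  have hle := ({e, f, j} : Finset (Fin (n + 1))).card_le_univ
  apply hα.quadric
  rw [Finset.card_compl, Fintype.card_fin, h3]
  simp only [h3, Fintype.card_fin] at hle
  omega

theorem form_comm
    (hL : ∀ e ∈ S, ∀ f ∈ S, e ≠ f → specialQuadric α {e, f, j} = MvPolynomial.X j * L e f)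
    {e f : Fin (n + 1)} (he : e ∈ S) (hf : f ∈ S) : L e f = L f e := by
  rcases eq_or_ne e f with rfl | hef
  · rfl
  apply mul_left_cancel₀ (MvPolynomial.X_ne_zero (R := k) j)
  rw [← hL e he f hf hef, ← hL f hf e he hef.symm, Finset.insert_comm]

theorem isHomogeneous_of_mem_formSpan (hα : IsLinearSyzygy X α) (hj : j ∉ S)
    (hL : ∀ e ∈ S, ∀ f ∈ S, e ≠ f → specialQuadric α {e, f, j} = MvPolynomial.X j * L e f)
    {q : CoordRing k n} (hq : q ∈ formSpan S L) : q.IsHomogeneous 1 := by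
  rw [← MvPolynomial.mem_homogeneousSubmodule]
  refine (Submodule.span_le.mpr ?_ : formSpan S L ≤ _) hq
  rintro _ ⟨e, he, f, hf, hef, rfl⟩
  exact isHomogeneous_form hα hj hL he hf hef

end Relation

/-! ### The alternating matrix of linear forms -/

/-- A relation that is alternating in its three indices holds if it holds for increasing ones. -/
theorem plucker_of_sorted {k σ : Type*} [CommRing k] [LinearOrder σ] (y : σ → k) (ω : σ → σ → k)
    (h0 : ∀ a, ω a a = 0) (hanti : ∀ a b, ω b a = -ω a b)
    (h : ∀ a b c, a < b → b < c → y a * ω b c - y b * ω a c + y c * ω a b = 0) (a b c : σ) :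
    y a * ω b c - y b * ω a c + y c * ω a b = 0 := by
  rcases lt_trichotomy a b with hab | rfl | hab
  · rcases lt_trichotomy b c with hbc | rfl | hbc
    · exact h a b c hab hbc
    · simp [h0]
    · rcases lt_trichotomy a c with hac | rfl | hac
      · linear_combination -h a c b hac hbc + y a * hanti c b
      · linear_combination y a * hanti a b - y b * h0 a
      · linear_combination h c a b hac hab + y a * hanti c b - y b * hanti c a
  · linear_combination y c * h0 a
  · rcases lt_trichotomy b c with hbc | rfl | hbc
    · rcases lt_trichotomy a c with hac | rfl | hac
      · linear_combination -h b a c hab hac + y c * hanti b a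
      · linear_combination y a * hanti b a - y b * h0 a
      · linear_combination h b c a hbc hac - y b * hanti c a + y c * hanti b a
    · linear_combination y a * h0 b
    · linear_combination -h c b a hbc hab + y a * hanti c b - y b * hanti c a + y c * hanti b a

section AlternatingForm

variable {k : Type*} [Field k] {n : ℕ}

/-- The entries `± L a b` of the alternating matrix of linear forms attached to the family `L`. -/
noncomputable def alternatingEntry (j : Fin (n + 1)) (S : Finset (Fin (n + 1)))
    (L : Fin (n + 1) → Fin (n + 1) → CoordRing k n) (a b : S) : formSpan S L :=
  if h : a = b then 0 else
    ((if a < b then 1 else -1) * indexSign k j a * indexSign k j b) •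
      ⟨L a b, Submodule.subset_span ⟨a, a.2, b, b.2, fun h' => h (Subtype.ext h'), rfl⟩⟩

theorem alternatingEntry_self (j : Fin (n + 1)) (S : Finset (Fin (n + 1)))
    (L : Fin (n + 1) → Fin (n + 1) → CoordRing k n) (a : S) : alternatingEntry j S L a a = 0 :=
  dif_pos rfl

theorem coe_alternatingEntry (j : Fin (n + 1)) (S : Finset (Fin (n + 1)))
    (L : Fin (n + 1) → Fin (n + 1) → CoordRing k n) {a b : S} (h : a ≠ b) :
    (alternatingEntry j S L a b : CoordRing k n) =
      ((if a < b then 1 else -1) * indexSign k j a * indexSign k j b) • L a b := by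
  rw [alternatingEntry, dif_neg h]
  rfl

variable {X : Set (ℙ k (Fin (n + 1) → k))}
  {α : Finset (Fin (n + 1)) → CoordRing k n} {j : Fin (n + 1)} {S : Finset (Fin (n + 1))}
  {L : Fin (n + 1) → Fin (n + 1) → CoordRing k n}

theorem alternatingEntry_swap
    (hL : ∀ e ∈ S, ∀ f ∈ S, e ≠ f → specialQuadric α {e, f, j} = MvPolynomial.X j * L e f)
    (a b : S) : alternatingEntry j S L b a = -alternatingEntry j S L a b := by
  rcases eq_or_ne a b with rfl | h
  · simp [alternatingEntry_self]
  apply Subtype.ext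
  rw [Submodule.coe_neg, coe_alternatingEntry j S L h, coe_alternatingEntry j S L h.symm,
    form_comm hL b.2 a.2, ← neg_smul]
  congr 1
  rcases lt_or_gt_of_ne h with h | h
  · simp only [h, h.not_gt, if_true, if_false]
    ring
  · simp only [h, h.not_gt, if_true, if_false]
    ring

/-- Multiplying `quadric_relation` by the three index signs moves them all into the entries `±
L_ab`, which leaves `y ∧ ω = 0`. -/
theorem eval_alternatingEntry_plucker (hα : IsLinearSyzygy X α) (hj : j ∉ S)
    (hL : ∀ e ∈ S, ∀ f ∈ S, e ≠ f → specialQuadric α {e, f, j} = MvPolynomial.X j * L e f)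
    {x : ℙ k (Fin (n + 1) → k)} (hx : x ∈ X) (a b c : S) :
    x.rep a * MvPolynomial.eval x.rep (alternatingEntry j S L b c : CoordRing k n) -
      x.rep b * MvPolynomial.eval x.rep (alternatingEntry j S L a c : CoordRing k n) +
      x.rep c * MvPolynomial.eval x.rep (alternatingEntry j S L a b : CoordRing k n) = 0 := by
  refine plucker_of_sorted (fun s : S => x.rep s)
    (fun a b => MvPolynomial.eval x.rep (alternatingEntry j S L a b : CoordRing k n))
    (fun a => by simp [alternatingEntry_self])
    (fun a b => by rw [alternatingEntry_swap hL a b]; simp) ?_ a b c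
  intro a b c hab hbc
  have hac := hab.trans hbc
  have hrel := quadric_relation hα hj hL a.2 b.2 c.2 hab hbc
  have h0 := hrel x.rep ⟨x.rep_nonzero, by rwa [Projectivization.mk_rep]⟩
  rw [MvPolynomial.aeval_eq_eval] at h0
  simp only [map_add, map_sub, map_mul, MvPolynomial.eval_X, map_indexSign] at h0
  rw [coe_alternatingEntry j S L hab.ne, coe_alternatingEntry j S L hbc.ne,
    coe_alternatingEntry j S L hac.ne]
  simp only [hab, hbc, hac, if_true, MvPolynomial.smul_eval]
  have ha := indexSign_mul_self k j (a : Fin (n + 1))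
  have hb := indexSign_mul_self k j (b : Fin (n + 1))
  have hc := indexSign_mul_self k j (c : Fin (n + 1))
  set A := MvPolynomial.eval x.rep (L b c)
  set B := MvPolynomial.eval x.rep (L a c)
  set C := MvPolynomial.eval x.rep (L a b)
  set s := indexSign k j (a : Fin (n + 1))
  set t := indexSign k j (b : Fin (n + 1))
  set r := indexSign k j (c : Fin (n + 1))
  linear_combination s * t * r * h0 - x.rep a * t * r * A * ha + x.rep b * s * r * B * hb -
    x.rep c * s * t * C * hc

theorem eval_eq_zero_of_alternatingEntry {v : Fin (n + 1) → k}
    (h : ∀ a b : S, MvPolynomial.eval v (alternatingEntry j S L a b : CoordRing k n) = 0)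
    {q : CoordRing k n} (hq : q ∈ formSpan S L) : MvPolynomial.eval v q = 0 := by
  refine (Submodule.span_le.mpr ?_ :
    formSpan S L ≤ LinearMap.ker (MvPolynomial.aeval v : CoordRing k n →ₐ[k] k).toLinearMap) hq
  rintro _ ⟨e, he, f, hf, hef, rfl⟩
  have hne : (⟨e, he⟩ : S) ≠ ⟨f, hf⟩ := fun h' => hef (congrArg Subtype.val h')
  have h1 := h ⟨e, he⟩ ⟨f, hf⟩
  rw [coe_alternatingEntry j S L hne, MvPolynomial.smul_eval] at h1
  have hs : ∀ l, indexSign k j l ≠ 0 := fun l h' => by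
    simpa [h'] using indexSign_mul_self k j l
  refine (mul_eq_zero.mp h1).resolve_left (mul_ne_zero (mul_ne_zero ?_ (hs _)) (hs _))
  split_ifs <;> simp

theorem exists_subspaces_vanishing (hX : X.Finite) (hα : IsLinearSyzygy X α) (hj : j ∉ S)
    (hL : ∀ e ∈ S, ∀ f ∈ S, e ≠ f → specialQuadric α {e, f, j} = MvPolynomial.X j * L e f)
    (hd_pos : 0 < Module.finrank k (formSpan S L)) :
    ∃ (W : Submodule k (formSpan S L)) (N : Submodule k (S → k)), 0 < Module.finrank k W ∧
      S.card ≤ 1 + Module.finrank k N + Module.finrank k W ∧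
      ∀ x ∈ X, (∀ q ∈ W, MvPolynomial.eval x.rep (q : CoordRing k n) = 0) ∨
        ∀ w ∈ N, w ⬝ᵥ (fun s : S => x.rep s) = 0 := by
  have hfin : FiniteDimensional k (formSpan S L) := Module.finite_of_finrank_pos hd_pos
  have : Nonempty (Fin (Module.finrank k (formSpan S L))) := ⟨⟨0, hd_pos⟩⟩
  let B := Module.finBasis k (formSpan S L)
  let E (x : ℙ k (Fin (n + 1) → k)) : formSpan S L →ₗ[k] k :=
    (MvPolynomial.aeval x.rep : CoordRing k n →ₐ[k] k).toLinearMap ∘ₗ (formSpan S L).subtype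
  have hE : ∀ x q, E x q = MvPolynomial.eval x.rep (q : CoordRing k n) := fun x q => rfl
  let ω := alternatingEntry j S L
  -- The other points of `X` impose nothing: where `y = 0` every functional of `N` vanishes, and
  -- where `ω = 0` all of `V` vanishes.
  let Q : Set (ℙ k (Fin (n + 1) → k)) :=
    {x | x ∈ X ∧ (fun s : S => x.rep s) ≠ 0 ∧ ∃ a b, E x (ω a b) ≠ 0}
  have : Finite Q := hX.subset fun x hx => hx.1
  let l : Q → Fin (Module.finrank k (formSpan S L)) → k := fun p i => E p (B i)
  have hl : ∀ p q, l p ⬝ᵥ B.equivFun q = E p q := by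
    intro p q
    have h := congrArg (E p) (B.sum_equivFun q)
    rw [map_sum] at h
    rw [← h, dotProduct]
    refine Finset.sum_congr rfl fun i _ => ?_
    rw [map_smul, smul_eq_mul, mul_comm]
  obtain ⟨c, N, W, hWpos, hcard, hN, hW⟩ := exists_subset_card_le
    (fun (p : Q) (s : S) => p.1.rep s) l (fun a b => B.equivFun (ω a b))
    (fun p => p.2.2.1) (fun p => by simpa only [hl] using p.2.2.2)
    (fun p a b c => by
      simp only [hl]
      exact eval_alternatingEntry_plucker hα hj hL p.2.1 a b c)
  rw [Fintype.card_coe] at hcard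
  have hWW : Module.finrank k (W.map (B.equivFun.symm : _ →ₗ[k] formSpan S L)) =
    Module.finrank k W := LinearEquiv.finrank_map_eq B.equivFun.symm W
  refine ⟨W.map (B.equivFun.symm : _ →ₗ[k] formSpan S L), N, by rwa [hWW], by rwa [hWW],
    fun x hx => ?_⟩
  by_cases hy : (fun s : S => x.rep s) = 0
  · right
    intro w _
    rw [hy, dotProduct_zero]
  by_cases hx' : ∃ a b, E x (ω a b) ≠ 0
  · let p : Q := ⟨x, hx, hy, hx'⟩
    by_cases hc : c p
    · exact Or.inr fun w hw => hN w hw p hc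
    · left
      rintro _ ⟨v, hv, rfl⟩
      have h := hl p (B.equivFun.symm v)
      rw [LinearEquiv.apply_symm_apply, hW v hv p hc] at h
      exact h.symm
  · push Not at hx'
    exact Or.inl fun q _ => eval_eq_zero_of_alternatingEntry hx' q.2

end AlternatingForm

/-! ### Products in the defining ideal and the theorem -/

theorem mul_mem_definingIdeal {k : Type*} [Field k] {n : ℕ} {X : Set (ℙ k (Fin (n + 1) → k))}
    {f h : CoordRing k n} (hf : f.IsHomogeneous 1) (hh : h.IsHomogeneous 1)
    (H : ∀ x ∈ X, MvPolynomial.eval x.rep f = 0 ∨ MvPolynomial.eval x.rep h = 0) :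
    f * h ∈ definingIdeal X := by
  rintro v ⟨hv, hx⟩
  obtain ⟨r, hr⟩ := Projectivization.exists_smul_eq_mk_rep k v hv
  have h0 := H _ hx
  rw [← hr, Units.smul_def, eval_smul_of_isHomogeneous_one hf,
    eval_smul_of_isHomogeneous_one hh] at h0
  rw [MvPolynomial.aeval_eq_eval]
  simpa using h0

theorem theorem3p1 {k : Type*} [Field k] [IsAlgClosed k] {n : ℕ}
    (X : Set (ℙ k (Fin (n + 1) → k))) (hX : X.Finite)
    (hspan : Projectivization.Subspace.span X = ⊤)
    (α : Finset (Fin (n + 1)) → CoordRing k n) (hα : IsLinearSyzygy X α)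
    (hsq : ∀ C : Finset (Fin (n + 1)), C.card = 3 → IsSquarefreeForm (specialQuadric α C))
    (j : Fin (n + 1)) (S : Finset (Fin (n + 1))) (hj : j ∉ S)
    (L : Fin (n + 1) → Fin (n + 1) → CoordRing k n)
    (hL : ∀ e ∈ S, ∀ f ∈ S, e ≠ f →
      specialQuadric α {e, f, j} = MvPolynomial.X j * L e f)
    (hd_pos : 0 < Module.finrank k (formSpan S L))
    (hd_lt : Module.finrank k (formSpan S L) + 1 < S.card) :
    ∃ t : ℕ, 0 < t ∧ t ≤ Module.finrank k (formSpan S L) ∧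
      ∃ (b : Module.Basis (Fin (Module.finrank k (formSpan S L))) k (formSpan S L))
        (g : Fin t ↪ Fin (Module.finrank k (formSpan S L)))
        (h : Fin (S.card - 1 - t) → CoordRing k n),
        (∀ r, (h r).IsHomogeneous 1) ∧ LinearIndependent k h ∧
        Ideal.span (Set.range fun a => (b (g a) : CoordRing k n)) * Ideal.span (Set.range h) ≤
          definingIdeal X := by
  have hfin : FiniteDimensional k (formSpan S L) := Module.finite_of_finrank_pos hd_pos
  obtain ⟨W, N, hW, hcard, hWN⟩ := exists_subspaces_vanishing hX hα hj hL hd_pos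
  obtain ⟨b, g, hbg⟩ := exists_basis_extending W
  -- Here `t = dim W`. The dimension count gives `dim N ≥ m - 1 - t`, enough independent functionals
  -- for the `h_r`.
  obtain ⟨w, hw⟩ := exists_linearIndependent_of_le_finrank (R := k) (M := N)
    (n := S.card - 1 - Module.finrank k W) (by omega)
  refine ⟨Module.finrank k W, hW, W.finrank_le, b, g,
    fun r => linearFormOn S (w r : S → k), fun r => isHomogeneous_linearFormOn S _, ?_, ?_⟩
  · exact (hw.map' _ N.ker_subtype).map' _ (LinearMap.ker_eq_bot.mpr (linearFormOn_injective S))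
  rw [Ideal.span_mul_span', Ideal.span_le]
  rintro _ ⟨_, ⟨a, rfl⟩, _, ⟨r, rfl⟩, rfl⟩
  refine mul_mem_definingIdeal (isHomogeneous_of_mem_formSpan hα hj hL (b (g a)).2)
    (isHomogeneous_linearFormOn S _) fun x hx => ?_
  refine (hWN x hx).imp (fun h => h _ (hbg a)) fun h => ?_
  rw [eval_linearFormOn]
  exact h _ (w r).2
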